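/- Let $d\ge 3$, let $\mathbb S^{d-1}$ be the unit sphere of $\mathbb R^d$, and let $A$ be a real symmetric $d\times d$ matrix with eigenvalues $\lambda_1\ge\lambda_2\ge\dots\ge\lambda_d$ (with multiplicity) such that $\lambda_1=\lambda_2=\lambda_3=\lambda>0$ and $|\lambda_d|\le\lambda$. Let $\phi$ be a real function that is twice differentiable on $[-\lambda,\lambda]$ (one-sidedly at the end points), with $\phi'>0$ and $\phi''\ge 0$ on $[-\lambda,\lambda]$. For a Borel probability measure $\mu$ on $\mathbb S^{d-1}$ put $$\mathsf E_\phi[\mu]=\frac12\iint \phi(\langle Ax,y\rangle)\,d\mu(x)\,d\mu(y).$$ Then every local maximum $\mu$ of $\mathsf E_\phi$ over the space $\mathcal P(\mathbb S^{d-1})$ of Borel probability measures with the 2-Wasserstein distance $W_2$ (that is, every $\mu$ for which there is $\varepsilon>0$ with $\mathsf E_\phi[\nu]\le\mathsf E_\phi[\mu]$ whenever $W_2(\mu,\nu)<\varepsilon$) is a global maximum of $\mathsf E_\phi$. Moreover, the global maxima are exactly the point masses $\mu=\delta_{x_0}$ with $x_0\in\mathbb S^{d-1}$ and $Ax_0=\lambda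 x_0$. -/

import Mathlib

open MeasureTheory

noncomputable section

/-- The unit sphere of `ℝ^d`, with its Euclidean (chordal) distance and its Borel sets. -/
abbrev UnitSphere (d : ℕ) : Type :=
  Metric.sphere (0 : EuclideanSpace ℝ (Fin d)) 1

/-- The matrix-vector product `A x` for `x ∈ ℝ^d`. -/
abbrev mulVecE {d : ℕ} (A : Matrix (Fin d) (Fin d) ℝ) (x : EuclideanSpace ℝ (Fin d)) :
    EuclideanSpace ℝ (Fin d) :=
  Matrix.toEuclideanLin A x

/-- A real symmetric matrix acts as a symmetric operator on `ℝ^d`. -/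
theorem symmOperator {d : ℕ} {A : Matrix (Fin d) (Fin d) ℝ} (hA : A.IsSymm) :
    (Matrix.toEuclideanLin A).IsSymmetric := by
  rw [Matrix.isSymmetric_toEuclideanLin_iff, Matrix.IsHermitian,
    Matrix.conjTranspose_eq_transpose_of_trivial]
  exact hA

/-- The eigenvalues `λ_1 ≥ λ_2 ≥ … ≥ λ_d` of a real symmetric matrix, counted with multiplicity,
in decreasing order; `sortedEigenvalue hA i` is `λ_{i+1}`. -/
def sortedEigenvalue {d : ℕ} {A : Matrix (Fin d) (Fin d) ℝ} (hA : A.IsSymm) : Fin d → ℝ :=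
  (symmOperator hA).eigenvalues finrank_euclideanSpace_fin

/-- The interaction energy `E_φ[μ] = ½ ∬ φ(⟨A x, y⟩) dμ(x) dμ(y)`. -/
def interactionEnergy {d : ℕ} (A : Matrix (Fin d) (Fin d) ℝ) (φ : ℝ → ℝ)
    (μ : ProbabilityMeasure (UnitSphere d)) : ℝ :=
  (1 / 2 : ℝ) * ∫ x : UnitSphere d, ∫ y : UnitSphere d,
    φ (inner ℝ (mulVecE A (x : EuclideanSpace ℝ (Fin d))) (y : EuclideanSpace ℝ (Fin d)))
      ∂(μ : Measure (UnitSphere d)) ∂(μ : Measure (UnitSphere d))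

/-- The couplings of two probability measures. -/
def couplings {X : Type*} [MeasurableSpace X] (μ ν : ProbabilityMeasure X) :
    Set (Measure (X × X)) :=
  {γ | γ.map Prod.fst = (μ : Measure X) ∧ γ.map Prod.snd = (ν : Measure X)}

open scoped ENNReal in
/-- The 2-Wasserstein distance
`W_2(μ, ν) = (inf over couplings γ of μ and ν of ∬ dist(x, y)² dγ(x, y))^{1/2}`. -/
def wasserstein2 {X : Type*} [MeasurableSpace X] [PseudoEMetricSpace X]
    (μ ν : ProbabilityMeasure X) : ℝ≥0∞ :=
  (⨅ γ ∈ couplings μ ν, ∫⁻ p, edist p.1 p.2 ^ 2 ∂γ) ^ (1 / 2 : ℝ)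

/-- `μ` is a local maximum of the functional `E` for the distance `W_2`. -/
def IsWassersteinLocalMax {X : Type*} [MeasurableSpace X] [PseudoEMetricSpace X]
    (E : ProbabilityMeasure X → ℝ) (μ : ProbabilityMeasure X) : Prop :=
  ∃ ε > 0, ∀ ν : ProbabilityMeasure X, wasserstein2 μ ν < ε → E ν ≤ E μ

/-- `μ` is a global maximum of the functional `E`. -/
def IsGlobalMax {X : Type*} [MeasurableSpace X]
    (E : ProbabilityMeasure X → ℝ) (μ : ProbabilityMeasure X) : Prop :=
  ∀ ν : ProbabilityMeasure X, E ν ≤ E μ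

end

/-!
A Lorentz boost along a unit vector `v` permutes the rays of the light cone, hence acts on the
unit sphere; this is the conformal flow of `x ↦ v - ⟪v, x⟫ x`. If `T v = lam • v`, the form
`lam * x₀ * y₀ - ⟪T x, y⟫`, where `x₀` and `y₀` are the time components, is invariant under the
boost, so along the flow `lam - ⟪T x, y⟫` is divided by the two boost times. Averaged over `±t`,
the resulting gain of `⟪T x, y⟫` is of second order in `t`, with coefficient `lam - ⟪T x, y⟫` times
`1 - ⟪v, x⟫ ^ 2 - ⟪v, y⟫ ^ 2 - ⟪v, x⟫ * ⟪v, y⟫`. By Bessel's inequality the sum of the latter over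
three orthonormal eigenvectors is nonnegative, and it vanishes only if `x = y` lies in their span.
Convexity of `φ` turns this into a gain of energy. At a local maximum the gain must vanish, so
`⟪T x, y⟫ = lam` almost everywhere, which says that the measure is a point mass at an eigenvector.
-/
open Filter Metric Real Set
open scoped ENNReal RealInnerProductSpace Topology

section Convexity

variable {φ : ℝ → ℝ} {a b : ℝ}

theorem convexOn_of_derivWithin2_nonneg {D : Set ℝ} (hD : Convex ℝ D)
    (hφ : DifferentiableOn ℝ φ D) (hφ' : DifferentiableOn ℝ (derivWithin φ D) D)
    (hφ'' : ∀ s ∈ D, 0 ≤ derivWithin (derivWithin φ D) D s) : ConvexOn ℝ D φ :=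
  convexOn_of_hasDerivWithinAt2_nonneg hD hφ.continuousOn
    (fun s hs ↦ (hφ s (interior_subset hs)).hasDerivWithinAt.mono interior_subset)
    (fun s hs ↦ (hφ' s (interior_subset hs)).hasDerivWithinAt.mono interior_subset)
    (fun s hs ↦ hφ'' s (interior_subset hs))

theorem exists_subgradient_of_mem_interior {D : Set ℝ} (hφ : ConvexOn ℝ D φ) {s : ℝ}
    (hs : s ∈ interior D) : ∃ k, ∀ t ∈ D, k * (t - s) ≤ φ t - φ s := by
  refine ⟨derivWithin φ (Ioi s) s, fun t ht ↦ ?_⟩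
  rcases lt_trichotomy t s with hts | rfl | hst
  · have hslope := (hφ.slope_le_leftDeriv_of_mem_interior ht hs hts).trans
      (hφ.leftDeriv_le_rightDeriv_of_mem_interior hs)
    rw [slope_def_field, div_le_iff₀ (sub_pos.2 hts)] at hslope
    linarith
  · simp
  · have hslope := hφ.rightDeriv_le_slope_of_mem_interior hs ht hst
    rwa [slope_def_field, le_div_iff₀ (sub_pos.2 hst)] at hslope

theorem derivWithin_Icc_left_mul_le_sub (hφ : ConvexOn ℝ (Icc a b) φ)
    (hd : DifferentiableWithinAt ℝ φ (Icc a b) a) {s t : ℝ} (hs : s ∈ Icc a b)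
    (ht : t ∈ Icc a b) (hst : s ≤ t) :
    derivWithin φ (Icc a b) a * (t - s) ≤ φ t - φ s := by
  rcases hst.eq_or_lt with rfl | hst
  · simp
  have ha : a ∈ Icc a b := left_mem_Icc.2 (hs.1.trans hs.2)
  have hslope_at : derivWithin φ (Icc a b) a ≤ slope φ a t :=
    hφ.derivWithin_le_slope ha ht (hs.1.trans_lt hst) hd
  have hslope : derivWithin φ (Icc a b) a ≤ slope φ s t := by
    rw [slope_comm φ a t] at hslope_at
    rw [slope_comm φ s t]
    exact hslope_at.trans <| hφ.slope_mono ht ⟨ha, (hs.1.trans_lt hst).ne⟩ ⟨hs, hst.ne⟩ hs.1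
  rwa [slope_def_field, le_div_iff₀ (sub_pos.2 hst)] at hslope

theorem strictMonoOn_of_convexOn_of_derivWithin_left_pos (hφ : ConvexOn ℝ (Icc a b) φ)
    (hd : 0 < derivWithin φ (Icc a b) a) : StrictMonoOn φ (Icc a b) := by
  intro s hs t ht hst
  have hgrowth := derivWithin_Icc_left_mul_le_sub hφ
    (differentiableWithinAt_of_derivWithin_ne_zero hd.ne') hs ht hst.le
  linarith [mul_pos hd (sub_pos.2 hst)]

/-- The slope is taken relative to the right end point: a subgradient `k` of `φ` at `s` gives
`c = k * (b - s)`, while at `s = b`, where `φ` may have no subgradient, `c = 0` works. -/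
theorem exists_gain_slope (hφ : ConvexOn ℝ (Icc a b) φ)
    (hd : DifferentiableWithinAt ℝ φ (Icc a b) a) {s : ℝ} (hs : s ∈ Icc a b) :
    ∃ c, derivWithin φ (Icc a b) a * (b - s) ≤ c ∧ c ≤ φ b - φ s ∧
      ∀ r, b - (b - s) * r ∈ Icc a b → c * (1 - r) ≤ φ (b - (b - s) * r) - φ s := by
  rcases hs.2.eq_or_lt with rfl | hsb
  · exact ⟨0, by simp, by simp, by simp⟩
  have ha : a ∈ Icc a b := left_mem_Icc.2 (hs.1.trans hs.2)
  have hb : b ∈ Icc a b := right_mem_Icc.2 (hs.1.trans hs.2)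
  obtain ⟨k, hk_ge, hk⟩ : ∃ k, derivWithin φ (Icc a b) a ≤ k ∧
      ∀ t ∈ Icc a b, k * (t - s) ≤ φ t - φ s := by
    rcases hs.1.eq_or_lt with rfl | has
    · exact ⟨_, le_rfl, fun t ht ↦ derivWithin_Icc_left_mul_le_sub hφ hd hs ht ht.1⟩
    obtain ⟨k, hk⟩ := exists_subgradient_of_mem_interior hφ
      (show s ∈ interior (Icc a b) by rw [interior_Icc]; exact ⟨has, hsb⟩)
    refine ⟨k, le_of_mul_le_mul_right ?_ (sub_pos.2 has), hk⟩
    linarith [derivWithin_Icc_left_mul_le_sub hφ hd ha hs hs.1, hk a ha]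
  refine ⟨k * (b - s), mul_le_mul_of_nonneg_right hk_ge (sub_nonneg.2 hs.2), hk b hb,
    fun r hr ↦ ?_⟩
  calc k * (b - s) * (1 - r) = k * (b - (b - s) * r - s) := by ring
    _ ≤ φ (b - (b - s) * r) - φ s := hk _ hr

theorem measurable_comp_of_monotoneOn {X : Type*} [MeasurableSpace X] {f : X → ℝ} {D : Set ℝ}
    (hφ : MonotoneOn φ D) (hf : Measurable f) (hfD : ∀ x, f x ∈ D) : Measurable (φ ∘ f) := by
  have hmono : Monotone fun s : D ↦ φ s := fun s t hst ↦ hφ s.2 t.2 hst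
  exact hmono.measurable.comp (hf.subtype_mk (h := hfD))

end Convexity

section Eigenvectors

variable {E : Type*} [NormedAddCommGroup E] [InnerProductSpace ℝ E] {T : E →L[ℝ] E} {lam : ℝ}

theorem inner_mem_Icc_of_norm_le (hT : ‖T‖ ≤ lam) {x y : E} (hx : ‖x‖ = 1) (hy : ‖y‖ = 1) :
    ⟪T x, y⟫ ∈ Icc (-lam) lam := by
  rw [mem_Icc, ← abs_le]
  calc |⟪T x, y⟫| ≤ ‖T x‖ * ‖y‖ := abs_real_inner_le_norm _ _
    _ ≤ lam := by simpa [hx, hy] using T.le_of_opNorm_le hT x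

theorem apply_eq_smul_of_inner_eq (hT : ‖T‖ ≤ lam) {x y : E} (hx : ‖x‖ = 1) (hy : ‖y‖ = 1)
    (hxy : ⟪T x, y⟫ = lam) : T x = lam • y := by
  have hTx : ‖T x‖ ≤ lam := by simpa [hx] using T.le_of_opNorm_le hT x
  have hsq : ‖T x - lam • y‖ ^ 2 ≤ 0 := by
    rw [norm_sub_sq_real, inner_smul_right, norm_smul, hxy, hy, mul_one, Real.norm_eq_abs, sq_abs]
    linarith [pow_le_pow_left₀ (norm_nonneg (T x)) hTx 2]
  have hnorm := (pow_eq_zero_iff two_ne_zero).1 (hsq.antisymm (sq_nonneg _))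
  exact sub_eq_zero.1 (norm_eq_zero.1 hnorm)

/-- The quadratic form `λ² ‖x‖² - ‖T x‖²` is nonnegative and vanishes at `v`, so `v` lies in the
kernel of its polar form. -/
theorem inner_apply_eq_of_norm_le (hlam : 0 < lam) (hT : ‖T‖ ≤ lam) {v : E}
    (hTv : T v = lam • v) (x : E) : ⟪v, T x⟫ = lam * ⟪v, x⟫ := by
  have hform (r : ℝ) : 0 ≤ lam ^ 2 * ‖x‖ ^ 2 - ‖T x‖ ^ 2 +
      r * (2 * lam * (lam * ⟪v, x⟫ - ⟪v, T x⟫)) := by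
    have hle := pow_le_pow_left₀ (norm_nonneg _) (T.le_of_opNorm_le hT (x + r • v)) 2
    rw [map_add, map_smul, hTv, mul_pow, norm_add_sq_real, norm_add_sq_real, norm_smul, norm_smul,
      norm_smul, inner_smul_right, inner_smul_right, inner_smul_right, real_inner_comm,
      real_inner_comm v x, mul_pow, mul_pow, mul_pow, Real.norm_eq_abs lam, sq_abs] at hle
    linarith
  have hpolar : 2 * lam * (lam * ⟪v, x⟫ - ⟪v, T x⟫) = 0 := by
    by_contra hne
    have hneg := hform (-(lam ^ 2 * ‖x‖ ^ 2 - ‖T x‖ ^ 2 + 1) /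
      (2 * lam * (lam * ⟪v, x⟫ - ⟪v, T x⟫)))
    rw [div_mul_cancel₀ _ hne] at hneg
    linarith
  have hzero := (mul_eq_zero.1 hpolar).resolve_left (by positivity)
  linarith

end Eigenvectors

section ConformalFlow

variable {E : Type*} [NormedAddCommGroup E] [InnerProductSpace ℝ E]

/-- The time component of the image of `(1, x)` under the Lorentz boost of rapidity `t` in the
direction `v`. -/
noncomputable def boostTime (v : E) (t : ℝ) (x : E) : ℝ :=
  cosh t + sinh t * ⟪v, x⟫

/-- The space component of the image of `(1, x)` under the Lorentz boost of rapidity `t` in the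
direction `v`. -/
noncomputable def boostSpace (v : E) (t : ℝ) (x : E) : E :=
  x + (sinh t + (cosh t - 1) * ⟪v, x⟫) • v

theorem cosh_add_sinh_mul_pos (t : ℝ) {u : ℝ} (hu : |u| ≤ 1) : 0 < cosh t + sinh t * u := by
  have habs : |sinh t * u| < cosh t := by
    calc |sinh t * u| ≤ |sinh t| := by
          rw [abs_mul]; exact mul_le_of_le_one_right (abs_nonneg _) hu
      _ = sinh |t| := abs_sinh t
      _ < cosh t := cosh_abs t ▸ sinh_lt_cosh _
  linarith [(abs_lt.1 habs).1]

/-- On the span of the time axis and `v` the form `lam * x₀ * y₀ - ⟪T x, y⟫` is `lam` times the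
Minkowski form, and that span is orthogonal to its complement: hence it is invariant under boosts
along `v`. -/
theorem mul_boostTime_sub_inner_boostSpace {T : E →L[ℝ] E} {lam : ℝ} {v : E} (hv : ‖v‖ = 1)
    (hTv : T v = lam • v) (hTv' : ∀ x, ⟪v, T x⟫ = lam * ⟪v, x⟫) (t : ℝ) (x y : E) :
    lam * (boostTime v t x * boostTime v t y) - ⟪T (boostSpace v t x), boostSpace v t y⟫ =
      lam - ⟪T x, y⟫ := by
  have hvv : ⟪v, v⟫ = 1 := by rw [real_inner_self_eq_norm_sq, hv, one_pow]
  have hTxv : ⟪T x, v⟫ = lam * ⟪v, x⟫ := by rw [real_inner_comm, hTv']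
  simp only [boostTime, boostSpace, map_add, map_smul, hTv, inner_add_left, inner_add_right,
    real_inner_smul_left, real_inner_smul_right, hvv, hTxv]
  linear_combination lam * (1 - ⟪v, x⟫ * ⟪v, y⟫) * cosh_sq t

theorem norm_boostSpace_sq {v x : E} (hv : ‖v‖ = 1) (hx : ‖x‖ = 1) (t : ℝ) :
    ‖boostSpace v t x‖ ^ 2 = boostTime v t x ^ 2 := by
  have hform := mul_boostTime_sub_inner_boostSpace (T := .id ℝ E) (lam := 1) hv
    (by simp) (by simp) t x x
  simp only [ContinuousLinearMap.id_apply, real_inner_self_eq_norm_sq, hx] at hform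
  linarith

theorem boostTime_pos (v x : sphere (0 : E) 1) (t : ℝ) : 0 < boostTime (v : E) t x :=
  cosh_add_sinh_mul_pos t <| by simpa using abs_real_inner_le_norm (v : E) x

/-- The conformal flow of the unit sphere generated by the vector field `x ↦ v - ⟪v, x⟫ x`: the
action of the Lorentz boosts along `v` on the rays of the light cone, each of which is represented
by its point `(1, x)`. -/
noncomputable def conformalFlow (v : sphere (0 : E) 1) (t : ℝ) (x : sphere (0 : E) 1) :
    sphere (0 : E) 1 :=
  ⟨(boostTime (v : E) t x)⁻¹ • boostSpace (v : E) t x, by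
    have hpos := boostTime_pos v x t
    have hnorm : ‖boostSpace (v : E) t x‖ = boostTime (v : E) t x :=
      (sq_eq_sq₀ (norm_nonneg _) hpos.le).1
        (norm_boostSpace_sq (norm_eq_of_mem_sphere v) (norm_eq_of_mem_sphere x) t)
    rw [mem_sphere_zero_iff_norm, norm_smul, norm_inv, Real.norm_of_nonneg hpos.le, hnorm,
      inv_mul_cancel₀ hpos.ne']⟩

theorem coe_conformalFlow (v : sphere (0 : E) 1) (t : ℝ) (x : sphere (0 : E) 1) :
    (conformalFlow v t x : E) = (boostTime (v : E) t x)⁻¹ • boostSpace (v : E) t x :=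
  rfl

theorem continuous_conformalFlow (v : sphere (0 : E) 1) (t : ℝ) :
    Continuous (conformalFlow v t) := by
  have htime : Continuous fun x : sphere (0 : E) 1 ↦ boostTime (v : E) t x := by
    unfold boostTime; fun_prop
  have hspace : Continuous fun x : sphere (0 : E) 1 ↦ boostSpace (v : E) t x := by
    unfold boostSpace; fun_prop
  exact ((htime.inv₀ fun x ↦ (boostTime_pos v x t).ne').smul hspace).subtype_mk _

theorem sub_inner_conformalFlow {T : E →L[ℝ] E} {lam : ℝ} {v : sphere (0 : E) 1}
    (hTv : T v = lam • (v : E)) (hTv' : ∀ x, ⟪(v : E), T x⟫ = lam * ⟪(v : E), x⟫) (t : ℝ)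
    (x y : sphere (0 : E) 1) :
    lam - ⟪T (conformalFlow v t x), (conformalFlow v t y : E)⟫ =
      (lam - ⟪T x, (y : E)⟫) * (boostTime (v : E) t x * boostTime (v : E) t y)⁻¹ := by
  have hx := (boostTime_pos v x t).ne'
  have hy := (boostTime_pos v y t).ne'
  rw [← mul_boostTime_sub_inner_boostSpace (norm_eq_of_mem_sphere v) hTv hTv' t (x : E) (y : E),
    coe_conformalFlow, coe_conformalFlow, map_smul, real_inner_smul_left, real_inner_smul_right]
  field_simp

theorem dist_conformalFlow_le (v : sphere (0 : E) 1) (t : ℝ) (x : sphere (0 : E) 1) :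
    dist x (conformalFlow v t x) ≤ √(2 * (cosh t - 1)) := by
  have hpos := boostTime_pos v x t
  set u := ⟪(v : E), x⟫ with hu
  have hinner : ⟪(x : E), conformalFlow v t x⟫ =
      (boostTime (v : E) t x)⁻¹ * (1 + (sinh t + (cosh t - 1) * u) * u) := by
    rw [coe_conformalFlow, boostSpace, real_inner_smul_right, inner_add_right,
      real_inner_smul_right, real_inner_self_eq_norm_sq, norm_eq_of_mem_sphere, one_pow,
      real_inner_comm (v : E) (x : E), ← hu]
  have hdist : ‖(x : E) - conformalFlow v t x‖ ^ 2 =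
      2 * (cosh t - 1) * ((1 - u ^ 2) / boostTime (v : E) t x) := by
    rw [norm_sub_sq_real, hinner, norm_eq_of_mem_sphere, norm_eq_of_mem_sphere]
    field_simp
    rw [boostTime, ← hu]
    ring
  have hratio : (1 - u ^ 2) / boostTime (v : E) t x ≤ 1 := by
    have hu1 : u ^ 2 ≤ 1 := by
      rw [sq_le_one_iff_abs_le_one]
      simpa using abs_real_inner_le_norm (v : E) x
    rw [div_le_one hpos, boostTime, ← hu]
    have hsq : (1 - u ^ 2) * (cosh t + 1) ≤ 2 * (cosh t + sinh t * u) := by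
      refine le_of_mul_le_mul_right ?_ (by linarith [one_le_cosh t] : 0 < cosh t + 1)
      linarith [sq_nonneg (sinh t + u * (cosh t + 1)), cosh_sq t]
    linarith [mul_nonneg (sub_nonneg.2 hu1) (sub_nonneg.2 (one_le_cosh t))]
  refine Real.le_sqrt_of_sq_le ?_
  rw [Subtype.dist_eq, dist_eq_norm, hdist]
  exact mul_le_of_le_one_right (by linarith [one_le_cosh t]) hratio

end ConformalFlow

section SecondVariation

variable {E : Type*} [NormedAddCommGroup E] [InnerProductSpace ℝ E]

/-- The coefficient of `t ^ 2` in the relative gain `1 - (boostTime v t x * boostTime v t y)⁻¹`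
symmetrized in `t`. -/
def flowHessian (v x y : E) : ℝ :=
  1 - ⟪v, x⟫ ^ 2 - ⟪v, y⟫ ^ 2 - ⟪v, x⟫ * ⟪v, y⟫

theorem two_mul_sub_le_div_one_add_mul {α β σ κ : ℝ} (hα : α ∈ Icc 0 1) (hβ : β ∈ Icc 0 1)
    (hσ : 0 ≤ σ) (hκ : κ ≤ 1) :
    2 * (σ * κ - 2 * σ ^ 2) ≤
      2 * (σ * κ + σ ^ 2 * (α * β)) / ((1 + σ * α) * (1 + σ * β)) := by
  obtain ⟨hα₀, hα₁⟩ := hα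
  obtain ⟨hβ₀, hβ₁⟩ := hβ
  have hαβ : 0 ≤ α * β := mul_nonneg hα₀ hβ₀
  set N := (1 + σ * α) * (1 + σ * β) with hN
  have hN_sub : N - 1 = σ * (α + β + σ * (α * β)) := by rw [hN]; ring
  have hN_ge : 0 ≤ N - 1 := hN_sub ▸ by positivity
  have hN_le : N - 1 ≤ 2 * σ * N := by
    have hfactor : α + β + σ * (α * β) ≤ 2 * N := by
      linarith [mul_nonneg (mul_nonneg hσ hα₀) (sub_nonneg.2 hβ₁), mul_nonneg hσ hα₀,
        mul_nonneg hσ hβ₀, mul_nonneg (sq_nonneg σ) hαβ]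
    rw [hN_sub]
    linarith [mul_le_mul_of_nonneg_left hfactor hσ]
  rw [le_div_iff₀ (by linarith)]
  have hκN : σ * κ * (N - 1) ≤ 2 * σ ^ 2 * N :=
    calc σ * κ * (N - 1) ≤ σ * (N - 1) :=
          mul_le_mul_of_nonneg_right (mul_le_of_le_one_right hσ hκ) hN_ge
      _ ≤ σ * (2 * σ * N) := mul_le_mul_of_nonneg_left hN_le hσ
      _ = 2 * σ ^ 2 * N := by ring
  linarith [mul_nonneg (sq_nonneg σ) hαβ]

theorem boostTime_mul_boostTime_neg (v x : E) (t : ℝ) :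
    boostTime v t x * boostTime v (-t) x = 1 + sinh t ^ 2 * (1 - ⟪v, x⟫ ^ 2) := by
  simp only [boostTime, cosh_neg, sinh_neg]
  linear_combination cosh_sq t

theorem one_sub_inv_add_one_sub_inv_boostTime (v x y : sphere (0 : E) 1) (t : ℝ) :
    (1 - (boostTime (v : E) t x * boostTime (v : E) t y)⁻¹) +
        (1 - (boostTime (v : E) (-t) x * boostTime (v : E) (-t) y)⁻¹) =
      2 * (sinh t ^ 2 * flowHessian (v : E) x y +
          (sinh t ^ 2) ^ 2 * ((1 - ⟪(v : E), x⟫ ^ 2) * (1 - ⟪(v : E), y⟫ ^ 2))) /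
        ((1 + sinh t ^ 2 * (1 - ⟪(v : E), x⟫ ^ 2)) *
          (1 + sinh t ^ 2 * (1 - ⟪(v : E), y⟫ ^ 2))) := by
  have hx := (boostTime_pos v x t).ne'
  have hy := (boostTime_pos v y t).ne'
  have hx' := (boostTime_pos v x (-t)).ne'
  have hy' := (boostTime_pos v y (-t)).ne'
  have hadd : boostTime (v : E) t x * boostTime (v : E) t y +
      boostTime (v : E) (-t) x * boostTime (v : E) (-t) y =
        2 * (1 + sinh t ^ 2 * (1 + ⟪(v : E), x⟫ * ⟪(v : E), y⟫)) := by
    simp only [boostTime, cosh_neg, sinh_neg]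
    linear_combination 2 * cosh_sq t
  have hmul := congrArg₂ (· * ·) (boostTime_mul_boostTime_neg (v : E) x t)
    (boostTime_mul_boostTime_neg (v : E) y t)
  rw [← boostTime_mul_boostTime_neg, ← boostTime_mul_boostTime_neg]
  field_simp
  rw [flowHessian]
  linear_combination 2 * hmul - hadd

theorem inner_sq_mem_Icc (v x : sphere (0 : E) 1) : ⟪(v : E), x⟫ ^ 2 ∈ Icc 0 1 := by
  refine ⟨sq_nonneg _, (sq_le_one_iff_abs_le_one _).2 ?_⟩
  simpa using abs_real_inner_le_norm (v : E) x

theorem flowHessian_le_one (v x y : E) : flowHessian v x y ≤ 1 := by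
  unfold flowHessian
  nlinarith [sq_nonneg (⟪v, x⟫ + ⟪v, y⟫), sq_nonneg ⟪v, x⟫, sq_nonneg ⟪v, y⟫]

theorem sinh_sq_mul_flowHessian_le (v x y : sphere (0 : E) 1) (t : ℝ) :
    2 * (sinh t ^ 2 * flowHessian (v : E) x y - 2 * (sinh t ^ 2) ^ 2) ≤
      (1 - (boostTime (v : E) t x * boostTime (v : E) t y)⁻¹) +
        (1 - (boostTime (v : E) (-t) x * boostTime (v : E) (-t) y)⁻¹) := by
  rw [one_sub_inv_add_one_sub_inv_boostTime]
  exact two_mul_sub_le_div_one_add_mul (Icc.one_sub_mem (inner_sq_mem_Icc v x))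
    (Icc.one_sub_mem (inner_sq_mem_Icc v y)) (sq_nonneg _) (flowHessian_le_one _ _ _)

variable {ι : Type*} [Fintype ι]

theorem sum_flowHessian_eq (v : ι → E) (x y : E) :
    ∑ i, flowHessian (v i) x y = (Fintype.card ι - 3) + 3 / 2 * (1 - ∑ i, ⟪v i, x⟫ ^ 2) +
      3 / 2 * (1 - ∑ i, ⟪v i, y⟫ ^ 2) + 1 / 2 * ∑ i, (⟪v i, x⟫ - ⟪v i, y⟫) ^ 2 := by
  simp only [flowHessian, sub_sq, Finset.sum_add_distrib, Finset.sum_sub_distrib, mul_assoc,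
    ← Finset.mul_sum, Finset.sum_const, Finset.card_univ, nsmul_eq_mul]
  ring

theorem sum_sq_inner_le_one {v : ι → E} (hv : Orthonormal ℝ v) (x : sphere (0 : E) 1) :
    ∑ i, ⟪v i, x⟫ ^ 2 ≤ 1 := by
  simpa using hv.sum_inner_products_le (x : E) (s := Finset.univ)

theorem eq_sum_inner_smul_of_sum_sq_inner_eq {v : ι → E} (hv : Orthonormal ℝ v) {x : E}
    (h : ∑ i, ⟪v i, x⟫ ^ 2 = ‖x‖ ^ 2) : x = ∑ i, ⟪v i, x⟫ • v i := by
  have hproj : ‖x - ∑ i, ⟪v i, x⟫ • v i‖ ^ 2 = 0 := by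
    rw [norm_sub_sq_real, ← real_inner_self_eq_norm_sq (∑ i, ⟪v i, x⟫ • v i),
      hv.inner_sum, inner_sum, ← h]
    simp only [inner_smul_right, RCLike.conj_to_real, ← sq, real_inner_comm (v _) x]
    ring
  exact sub_eq_zero.1 (norm_eq_zero.1 ((pow_eq_zero_iff two_ne_zero).1 hproj))

theorem sum_flowHessian_nonneg (hι : 3 ≤ Fintype.card ι) {v : ι → E} (hv : Orthonormal ℝ v)
    (x y : sphere (0 : E) 1) : 0 ≤ ∑ i, flowHessian (v i) x y := by
  have hcard : (3 : ℝ) ≤ Fintype.card ι := mod_cast hι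
  have hdiff : 0 ≤ ∑ i, (⟪v i, x⟫ - ⟪v i, y⟫) ^ 2 := Finset.sum_nonneg fun i _ ↦ sq_nonneg _
  rw [sum_flowHessian_eq]
  linarith [sum_sq_inner_le_one hv x, sum_sq_inner_le_one hv y]

theorem eq_and_mem_span_of_sum_flowHessian_eq_zero (hι : 3 ≤ Fintype.card ι) {v : ι → E}
    (hv : Orthonormal ℝ v) {x y : sphere (0 : E) 1} (h : ∑ i, flowHessian (v i) x y = 0) :
    x = y ∧ (x : E) ∈ Submodule.span ℝ (range v) := by
  have hcard : (3 : ℝ) ≤ Fintype.card ι := mod_cast hι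
  have hx := sum_sq_inner_le_one hv x
  have hy := sum_sq_inner_le_one hv y
  have hdiff : 0 ≤ ∑ i, (⟪v i, x⟫ - ⟪v i, y⟫) ^ 2 := Finset.sum_nonneg fun i _ ↦ sq_nonneg _
  rw [sum_flowHessian_eq] at h
  have hcoord : ∀ i, ⟪v i, x⟫ = ⟪v i, y⟫ := by
    have hzero : ∑ i, (⟪v i, x⟫ - ⟪v i, y⟫) ^ 2 = 0 := by linarith
    rw [Fintype.sum_eq_zero_iff_of_nonneg fun i ↦ sq_nonneg _] at hzero
    exact fun i ↦ sub_eq_zero.1 ((pow_eq_zero_iff two_ne_zero).1 (congrFun hzero i))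
  have hx_sum : (x : E) = ∑ i, ⟪v i, x⟫ • v i :=
    eq_sum_inner_smul_of_sum_sq_inner_eq hv (by rw [norm_eq_of_mem_sphere]; linarith)
  have hy_sum : (y : E) = ∑ i, ⟪v i, y⟫ • v i :=
    eq_sum_inner_smul_of_sum_sq_inner_eq hv (by rw [norm_eq_of_mem_sphere]; linarith)
  refine ⟨Subtype.ext ?_, ?_⟩
  · rw [hx_sum, hy_sum]
    simp only [hcoord, ← hy_sum]
  · rw [hx_sum]
    exact sum_mem fun i _ ↦ Submodule.smul_mem _ _ (Submodule.subset_span (mem_range_self i))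

theorem inner_apply_eq_of_sum_flowHessian_eq_zero {T : E →L[ℝ] E} {lam : ℝ}
    (hι : 3 ≤ Fintype.card ι) {v : ι → E} (hv : Orthonormal ℝ v)
    (hTv : ∀ i, T (v i) = lam • v i) {x y : sphere (0 : E) 1}
    (h : ∑ i, flowHessian (v i) x y = 0) : ⟪T x, (y : E)⟫ = lam := by
  obtain ⟨rfl, hx⟩ := eq_and_mem_span_of_sum_flowHessian_eq_zero hι hv h
  have hTx : T x = lam • (x : E) :=
    LinearMap.eqOn_span (f := (T : E →ₗ[ℝ] E)) (g := lam • .id) (forall_mem_range.2 hTv) hx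
  rw [hTx, real_inner_smul_left, real_inner_self_eq_norm_sq, norm_eq_of_mem_sphere]
  ring

end SecondVariation

section Wasserstein

variable {X : Type*} [MeasurableSpace X] [PseudoEMetricSpace X] [OpensMeasurableSpace X]
  [SecondCountableTopology X]

theorem wasserstein2_map_le (μ : ProbabilityMeasure X) {Φ : X → X} (hΦ : Measurable Φ) {r : ℝ≥0∞}
    (hr : ∀ x, edist x (Φ x) ≤ r) : wasserstein2 μ (μ.map hΦ.aemeasurable) ≤ r := by
  have hgraph : Measurable fun x ↦ (x, Φ x) := measurable_id.prodMk hΦ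
  have hcoupling : (μ : Measure X).map (fun x ↦ (x, Φ x)) ∈ couplings μ (μ.map hΦ.aemeasurable) :=
    ⟨(Measure.map_map measurable_fst hgraph).trans Measure.map_id,
      Measure.map_map measurable_snd hgraph⟩
  have hcost : ∫⁻ p, edist p.1 p.2 ^ 2 ∂((μ : Measure X).map fun x ↦ (x, Φ x)) ≤ r ^ 2 := by
    rw [lintegral_map (by fun_prop) hgraph]
    calc ∫⁻ x, edist x (Φ x) ^ 2 ∂(μ : Measure X) ≤ ∫⁻ _, r ^ 2 ∂(μ : Measure X) :=
          lintegral_mono fun x ↦ pow_le_pow_left₀ zero_le (hr x) 2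
      _ = r ^ 2 := by simp
  calc wasserstein2 μ (μ.map hΦ.aemeasurable) ≤ (r ^ 2) ^ (1 / 2 : ℝ) :=
        ENNReal.rpow_le_rpow ((iInf₂_le _ hcoupling).trans hcost) (by norm_num)
    _ = r := by
        rw [← ENNReal.rpow_natCast, ← ENNReal.rpow_mul]
        norm_num

theorem IsWassersteinLocalMax.eventually_map_le {F : ProbabilityMeasure X → ℝ}
    {μ : ProbabilityMeasure X} (hμ : IsWassersteinLocalMax F μ) {α : Type*} {l : Filter α}
    {Φ : α → X → X} (hΦ : ∀ a, Measurable (Φ a)) {r : α → ℝ≥0∞}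
    (hdist : ∀ a x, edist x (Φ a x) ≤ r a) (hr : Tendsto r l (𝓝 0)) :
    ∀ᶠ a in l, F (μ.map (hΦ a).aemeasurable) ≤ F μ := by
  obtain ⟨ε, hε, hmax⟩ := hμ
  filter_upwards [hr.eventually_lt_const hε] with a ha
  exact hmax _ ((wasserstein2_map_le μ (hΦ a) (hdist a)).trans_lt ha)

end Wasserstein

section KernelEnergy

variable {X : Type*} [MeasurableSpace X]

/-- The interaction energy `½ ∬ K(x, y) dμ(x) dμ(y)` of a measure with respect to a kernel `K`. -/
noncomputable def kernelEnergy (K : X × X → ℝ) (μ : ProbabilityMeasure X) : ℝ :=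
  1 / 2 * ∫ x, ∫ y, K (x, y) ∂(μ : Measure X) ∂(μ : Measure X)

variable {K : X × X → ℝ} {m M : ℝ}

theorem kernelEnergy_eq_integral_prod (hK : Measurable K) (hmem : ∀ p, K p ∈ Icc m M)
    (μ : ProbabilityMeasure X) :
    kernelEnergy K μ = 1 / 2 * ∫ p, K p ∂((μ : Measure X).prod (μ : Measure X)) := by
  rw [kernelEnergy, integral_prod K (.of_mem_Icc m M hK.aemeasurable (.of_forall hmem))]

theorem kernelEnergy_map (hK : Measurable K) (hmem : ∀ p, K p ∈ Icc m M)
    (μ : ProbabilityMeasure X) {Φ : X → X} (hΦ : Measurable Φ) :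
    kernelEnergy K (μ.map hΦ.aemeasurable) =
      1 / 2 * ∫ p, K (Prod.map Φ Φ p) ∂((μ : Measure X).prod (μ : Measure X)) := by
  rw [kernelEnergy_eq_integral_prod hK hmem, ProbabilityMeasure.toMeasure_map,
    Measure.map_prod_map _ _ hΦ hΦ,
    integral_map (hΦ.prodMap hΦ).aemeasurable hK.aestronglyMeasurable]

theorem kernelEnergy_le (hK : Measurable K) (hmem : ∀ p, K p ∈ Icc m M)
    (μ : ProbabilityMeasure X) : kernelEnergy K μ ≤ 1 / 2 * M := by
  rw [kernelEnergy_eq_integral_prod hK hmem]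
  have hle : ∫ p, K p ∂((μ : Measure X).prod (μ : Measure X)) ≤
      ∫ _, M ∂((μ : Measure X).prod (μ : Measure X)) :=
    integral_mono (.of_mem_Icc m M hK.aemeasurable (.of_forall hmem)) (integrable_const M)
      fun p ↦ (hmem p).2
  rw [integral_const, probReal_univ, one_smul] at hle
  linarith

theorem kernelEnergy_eq_iff (hK : Measurable K) (hmem : ∀ p, K p ∈ Icc m M)
    {μ : ProbabilityMeasure X} :
    kernelEnergy K μ = 1 / 2 * M ↔ ∀ᵐ p ∂((μ : Measure X).prod (μ : Measure X)), K p = M := by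
  have hint : Integrable K ((μ : Measure X).prod (μ : Measure X)) :=
    .of_mem_Icc m M hK.aemeasurable (.of_forall hmem)
  have hiff := integral_eq_iff_of_ae_le hint (integrable_const M) (.of_forall fun p ↦ (hmem p).2)
  rw [integral_const, probReal_univ, one_smul] at hiff
  rw [kernelEnergy_eq_integral_prod hK hmem, mul_right_inj' (by norm_num), hiff]
  rfl

theorem isGlobalMax_kernelEnergy_iff (hK : Measurable K) (hmem : ∀ p, K p ∈ Icc m M) {x₀ : X}
    (hx₀ : K (x₀, x₀) = M) {μ : ProbabilityMeasure X} :
    IsGlobalMax (kernelEnergy K) μ ↔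
      ∀ᵐ p ∂((μ : Measure X).prod (μ : Measure X)), K p = M := by
  rw [← kernelEnergy_eq_iff hK hmem]
  refine ⟨fun hμ ↦ (kernelEnergy_le hK hmem μ).antisymm ?_, fun hμ ν ↦ ?_⟩
  · let δ : ProbabilityMeasure X := ⟨Measure.dirac x₀, inferInstance⟩
    have hδ : kernelEnergy K δ = 1 / 2 * M := by
      rw [kernelEnergy_eq_iff hK hmem, ProbabilityMeasure.coe_mk, Measure.dirac_prod_dirac]
      exact (ae_dirac_iff (hK (measurableSet_singleton M))).2 hx₀
    exact hδ ▸ hμ δ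
  · exact hμ ▸ kernelEnergy_le hK hmem ν

end KernelEnergy

theorem integral_nonpos_of_tendsto_nhdsGT_zero {Ω α : Type*} [MeasurableSpace Ω] {ρ : Measure Ω}
    [IsProbabilityMeasure ρ] {l : Filter α} [l.NeBot] {r : α → ℝ} (hr : Tendsto r l (𝓝[>] 0))
    {f : Ω → ℝ} {g : α → Ω → ℝ} {B : ℝ} (hf : Integrable f ρ) (hg : ∀ a, Integrable (g a) ρ)
    (hle : ∀ a ω, r a * f ω - r a ^ 2 * B ≤ g a ω) (hnonpos : ∀ᶠ a in l, ∫ ω, g a ω ∂ρ ≤ 0) :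
    ∫ ω, f ω ∂ρ ≤ 0 := by
  have hlim : Tendsto (fun a ↦ r a * B) l (𝓝 0) := by
    simpa using (hr.mono_right nhdsWithin_le_nhds).mul_const B
  refine ge_of_tendsto hlim ?_
  filter_upwards [hnonpos, hr.eventually self_mem_nhdsWithin] with a ha hra
  have hmono : r a * ∫ ω, f ω ∂ρ - r a ^ 2 * B ≤ 0 :=
    calc r a * ∫ ω, f ω ∂ρ - r a ^ 2 * B = ∫ ω, (r a * f ω - r a ^ 2 * B) ∂ρ := by
          rw [integral_sub (hf.const_mul _) (integrable_const _), integral_const_mul,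
            integral_const, probReal_univ, one_smul]
      _ ≤ ∫ ω, g a ω ∂ρ :=
          integral_mono ((hf.const_mul _).sub (integrable_const _)) (hg a) (hle a)
      _ ≤ 0 := ha
  refine le_of_mul_le_mul_left ?_ hra
  linarith

section SpherePairing

variable {E : Type*} [NormedAddCommGroup E] [InnerProductSpace ℝ E] {T : E →L[ℝ] E} {lam : ℝ}
  {φ : ℝ → ℝ}

/-- The pairing `⟪T x, y⟫` of two points of the unit sphere, as a kernel. -/
def spherePairing (T : E →L[ℝ] E) (p : sphere (0 : E) 1 × sphere (0 : E) 1) : ℝ :=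
  ⟪T p.1, (p.2 : E)⟫

theorem continuous_spherePairing (T : E →L[ℝ] E) : Continuous (spherePairing T) := by
  unfold spherePairing; fun_prop

theorem spherePairing_mem_Icc (hT : ‖T‖ ≤ lam) (p : sphere (0 : E) 1 × sphere (0 : E) 1) :
    spherePairing T p ∈ Icc (-lam) lam :=
  inner_mem_Icc_of_norm_le hT (norm_eq_of_mem_sphere p.1) (norm_eq_of_mem_sphere p.2)

theorem spherePairing_self {x : sphere (0 : E) 1} (hx : T x = lam • (x : E)) :
    spherePairing T (x, x) = lam := by
  rw [spherePairing, hx, real_inner_smul_left, real_inner_self_eq_norm_sq, norm_eq_of_mem_sphere]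
  ring

theorem comp_spherePairing_mem_Icc (hT : ‖T‖ ≤ lam) (hφ : MonotoneOn φ (Icc (-lam) lam))
    (p : sphere (0 : E) 1 × sphere (0 : E) 1) :
    (φ ∘ spherePairing T) p ∈ Icc (φ (-lam)) (φ lam) := by
  have hs := spherePairing_mem_Icc hT p
  have hle := hs.1.trans hs.2
  exact ⟨hφ (left_mem_Icc.2 hle) hs hs.1, hφ hs (right_mem_Icc.2 hle) hs.2⟩

variable [MeasurableSpace E] [OpensMeasurableSpace E] [SecondCountableTopology E]

theorem measurable_comp_spherePairing (hT : ‖T‖ ≤ lam) (hφ : MonotoneOn φ (Icc (-lam) lam)) :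
    Measurable (φ ∘ spherePairing T) :=
  measurable_comp_of_monotoneOn hφ (continuous_spherePairing T).measurable
    (spherePairing_mem_Icc hT)

theorem isGlobalMax_kernelEnergy_comp_spherePairing_iff (hT : ‖T‖ ≤ lam)
    {v : sphere (0 : E) 1} (hTv : T v = lam • (v : E)) (hφ : StrictMonoOn φ (Icc (-lam) lam))
    {μ : ProbabilityMeasure (sphere (0 : E) 1)} :
    IsGlobalMax (kernelEnergy (φ ∘ spherePairing T)) μ ↔
      ∀ᵐ p ∂((μ : Measure (sphere (0 : E) 1)).prod (μ : Measure (sphere (0 : E) 1))),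
        spherePairing T p = lam := by
  have hlam_mem : lam ∈ Icc (-lam) lam := spherePairing_self hTv ▸ spherePairing_mem_Icc hT (v, v)
  have hmax : (φ ∘ spherePairing T) (v, v) = φ lam := congrArg φ (spherePairing_self hTv)
  have hiff (p) : (φ ∘ spherePairing T) p = φ lam ↔ spherePairing T p = lam :=
    hφ.injOn.eq_iff (spherePairing_mem_Icc hT p) hlam_mem
  simp only [isGlobalMax_kernelEnergy_iff (measurable_comp_spherePairing hT hφ.monotoneOn)
    (comp_spherePairing_mem_Icc hT hφ.monotoneOn) hmax, hiff]

theorem ae_spherePairing_eq_iff_exists_dirac (hlam : 0 < lam) (hT : ‖T‖ ≤ lam)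
    {μ : ProbabilityMeasure (sphere (0 : E) 1)} :
    (∀ᵐ p ∂((μ : Measure (sphere (0 : E) 1)).prod (μ : Measure (sphere (0 : E) 1))),
        spherePairing T p = lam) ↔
      ∃ x₀ : sphere (0 : E) 1, T x₀ = lam • (x₀ : E) ∧
        (μ : Measure (sphere (0 : E) 1)) = Measure.dirac x₀ := by
  constructor
  · intro h
    have happly {x y : sphere (0 : E) 1} (hxy : spherePairing T (x, y) = lam) :
        T x = lam • (y : E) :=
      apply_eq_smul_of_inner_eq hT (norm_eq_of_mem_sphere x) (norm_eq_of_mem_sphere y) hxy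
    have hsections := Measure.ae_ae_of_ae_prod h
    obtain ⟨x, hx⟩ := hsections.exists
    obtain ⟨x₀, hx₀⟩ := hx.exists
    have hae : ∀ᵐ y ∂(μ : Measure (sphere (0 : E) 1)), y = x₀ := by
      filter_upwards [hx] with y hy
      exact Subtype.ext (smul_right_injective _ hlam.ne' ((happly hy).symm.trans (happly hx₀)))
    obtain ⟨y, rfl, hy⟩ := (hae.and hsections).exists
    obtain ⟨z, rfl, hz⟩ := (hae.and hy).exists
    exact ⟨z, happly hz,
      Measure.map_id.symm.trans (ProbabilityTheory.hasLaw_dirac_of_ae_eq hae).map_eq⟩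
  · rintro ⟨x₀, hx₀, hμ⟩
    rw [hμ, Measure.dirac_prod_dirac]
    have hmeas : MeasurableSet {p | spherePairing T p = lam} :=
      (continuous_spherePairing T).measurable (measurableSet_singleton lam)
    exact (ae_dirac_iff hmeas).2 (spherePairing_self hx₀)

end SpherePairing

section FlowGain

variable {E : Type*} [NormedAddCommGroup E] [InnerProductSpace ℝ E]

/-- The change of a kernel `K` at a pair of points that both move along `conformalFlow v` for
time `t`. -/
noncomputable def flowGain (K : sphere (0 : E) 1 × sphere (0 : E) 1 → ℝ) (v : sphere (0 : E) 1)
    (t : ℝ) (p : sphere (0 : E) 1 × sphere (0 : E) 1) : ℝ :=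
  K (Prod.map (conformalFlow v t) (conformalFlow v t) p) - K p

section Pointwise

variable {T : E →L[ℝ] E} {lam : ℝ} {φ : ℝ → ℝ} {ι : Type*} {v : ι → sphere (0 : E) 1}

theorem spherePairing_map_conformalFlow (hlam : 0 < lam) (hT : ‖T‖ ≤ lam) {v : sphere (0 : E) 1}
    (hTv : T v = lam • (v : E)) (t : ℝ) (p : sphere (0 : E) 1 × sphere (0 : E) 1) :
    spherePairing T (Prod.map (conformalFlow v t) (conformalFlow v t) p) =
      lam - (lam - spherePairing T p) * (boostTime (v : E) t p.1 * boostTime (v : E) t p.2)⁻¹ := by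
  have hsub : lam - spherePairing T (Prod.map (conformalFlow v t) (conformalFlow v t) p) = _ :=
    sub_inner_conformalFlow hTv (inner_apply_eq_of_norm_le hlam hT hTv) t p.1 p.2
  rw [← sub_sub_self lam (spherePairing T (Prod.map _ _ p)), hsub, spherePairing]

/-- The slope `c` is the same for all directions, so that these inequalities can be summed before
`c` is estimated: only the sum over the directions of `flowHessian` has a sign. -/
theorem exists_slope_mul_flowHessian_le_flowGain (hlam : 0 < lam) (hT : ‖T‖ ≤ lam)
    (hTv : ∀ i, T (v i) = lam • (v i : E)) (hφ : ConvexOn ℝ (Icc (-lam) lam) φ)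
    (hd : 0 < derivWithin φ (Icc (-lam) lam) (-lam))
    (p : sphere (0 : E) 1 × sphere (0 : E) 1) :
    ∃ c, derivWithin φ (Icc (-lam) lam) (-lam) * (lam - spherePairing T p) ≤ c ∧
      c ≤ φ lam - φ (spherePairing T p) ∧
      ∀ i t, c * (2 * (sinh t ^ 2 * flowHessian (v i : E) p.1 p.2 - 2 * (sinh t ^ 2) ^ 2)) ≤
        flowGain (φ ∘ spherePairing T) (v i) t p + flowGain (φ ∘ spherePairing T) (v i) (-t) p := by
  have hs := spherePairing_mem_Icc hT p
  obtain ⟨c, hc_ge, hc_le, hc⟩ :=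
    exists_gain_slope hφ (differentiableWithinAt_of_derivWithin_ne_zero hd.ne') hs
  have hc₀ : 0 ≤ c := (mul_nonneg hd.le (sub_nonneg.2 hs.2)).trans hc_ge
  have hgain (i : ι) (t : ℝ) :
      c * (1 - (boostTime (v i : E) t p.1 * boostTime (v i : E) t p.2)⁻¹) ≤
        flowGain (φ ∘ spherePairing T) (v i) t p := by
    have hflow := spherePairing_map_conformalFlow hlam hT (hTv i) t p
    rw [flowGain, Function.comp_apply, Function.comp_apply, hflow]
    exact hc _ (hflow ▸ spherePairing_mem_Icc hT _)
  refine ⟨c, hc_ge, hc_le, fun i t ↦ ?_⟩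
  calc _ ≤ c * _ := mul_le_mul_of_nonneg_left (sinh_sq_mul_flowHessian_le (v i) p.1 p.2 t) hc₀
    _ ≤ _ := by rw [mul_add]; exact add_le_add (hgain i t) (hgain i (-t))

theorem le_sum_flowGain [Fintype ι] (hι : 3 ≤ Fintype.card ι)
    (hv : Orthonormal ℝ fun i ↦ (v i : E)) (hlam : 0 < lam) (hT : ‖T‖ ≤ lam)
    (hTv : ∀ i, T (v i) = lam • (v i : E)) (hφ : ConvexOn ℝ (Icc (-lam) lam) φ)
    (hd : 0 < derivWithin φ (Icc (-lam) lam) (-lam))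
    (t : ℝ) (p : sphere (0 : E) 1 × sphere (0 : E) 1) :
    2 * sinh t ^ 2 * (derivWithin φ (Icc (-lam) lam) (-lam) *
          ((lam - spherePairing T p) * ∑ i, flowHessian (v i : E) p.1 p.2)) -
        (2 * sinh t ^ 2) ^ 2 * (Fintype.card ι * (φ lam - φ (-lam))) ≤
      ∑ i, (flowGain (φ ∘ spherePairing T) (v i) t p +
        flowGain (φ ∘ spherePairing T) (v i) (-t) p) := by
  obtain ⟨c, hc_ge, hc_le, hc⟩ :=
    exists_slope_mul_flowHessian_le_flowGain hlam hT hTv hφ hd p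
  have hs := spherePairing_mem_Icc hT p
  have hc_le' : c ≤ φ lam - φ (-lam) := hc_le.trans <| sub_le_sub_left
    ((strictMonoOn_of_convexOn_of_derivWithin_left_pos hφ hd).monotoneOn
      (left_mem_Icc.2 (by linarith)) hs hs.1) _
  refine le_trans ?_ (Finset.sum_le_sum fun i _ ↦ hc i t)
  rw [← Finset.mul_sum, ← Finset.mul_sum, Finset.sum_sub_distrib, ← Finset.mul_sum,
    Finset.sum_const, Finset.card_univ, nsmul_eq_mul]
  have hmain := mul_le_mul_of_nonneg_left (mul_le_mul_of_nonneg_right hc_ge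
    (sum_flowHessian_nonneg hι hv p.1 p.2)) (by positivity : 0 ≤ 2 * sinh t ^ 2)
  have herror := mul_le_mul_of_nonneg_left hc_le'
    (by positivity : 0 ≤ (2 * sinh t ^ 2) ^ 2 * Fintype.card ι)
  linarith

end Pointwise

variable [MeasurableSpace E] [BorelSpace E]
  {K : sphere (0 : E) 1 × sphere (0 : E) 1 → ℝ} {m M : ℝ}

theorem integrable_flowGain (hK : Measurable K) (hmem : ∀ p, K p ∈ Icc m M)
    (v : sphere (0 : E) 1) (t : ℝ) (ρ : Measure (sphere (0 : E) 1 × sphere (0 : E) 1))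
    [IsFiniteMeasure ρ] : Integrable (flowGain K v t) ρ := by
  have hflow := (continuous_conformalFlow v t).measurable
  exact .sub (.of_mem_Icc m M (hK.comp (hflow.prodMap hflow)).aemeasurable
    (.of_forall fun p ↦ hmem _)) (.of_mem_Icc m M hK.aemeasurable (.of_forall hmem))

variable [SecondCountableTopology E]

theorem eventually_integral_flowGain_nonpos (hK : Measurable K) (hmem : ∀ p, K p ∈ Icc m M)
    {μ : ProbabilityMeasure (sphere (0 : E) 1)} (hμ : IsWassersteinLocalMax (kernelEnergy K) μ)
    (v : sphere (0 : E) 1) :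
    ∀ᶠ t in 𝓝 0, ∫ p, flowGain K v t p
      ∂((μ : Measure (sphere (0 : E) 1)).prod (μ : Measure (sphere (0 : E) 1))) ≤ 0 := by
  have hflow (t : ℝ) := (continuous_conformalFlow v t).measurable
  have hlim : Tendsto (fun t ↦ ENNReal.ofReal (√(2 * (cosh t - 1)))) (𝓝 0) (𝓝 0) :=
    Continuous.tendsto' (ENNReal.continuous_ofReal.comp (by fun_prop)) _ _ (by simp)
  filter_upwards [hμ.eventually_map_le hflow
    (fun t x ↦ edist_le_ofReal (Real.sqrt_nonneg _) |>.2 (dist_conformalFlow_le v t x)) hlim]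
    with t ht
  rw [kernelEnergy_map hK hmem μ (hflow t), kernelEnergy_eq_integral_prod hK hmem] at ht
  have hsplit := integral_add
    (integrable_flowGain hK hmem v t ((μ : Measure (sphere (0 : E) 1)).prod μ))
    (.of_mem_Icc m M hK.aemeasurable (.of_forall hmem))
  simp only [flowGain, sub_add_cancel] at hsplit ⊢
  linarith

theorem eventually_integral_sum_flowGain_nonpos {ι : Type*} [Fintype ι] (hK : Measurable K)
    (hmem : ∀ p, K p ∈ Icc m M) {μ : ProbabilityMeasure (sphere (0 : E) 1)}
    (hμ : IsWassersteinLocalMax (kernelEnergy K) μ) (v : ι → sphere (0 : E) 1) :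
    ∀ᶠ t in 𝓝 0, ∫ p, ∑ i, (flowGain K (v i) t p + flowGain K (v i) (-t) p)
      ∂((μ : Measure (sphere (0 : E) 1)).prod (μ : Measure (sphere (0 : E) 1))) ≤ 0 := by
  have hpos := eventually_all.2 fun i ↦ eventually_integral_flowGain_nonpos hK hmem hμ (v i)
  have hneg : Tendsto (fun t : ℝ ↦ -t) (𝓝 0) (𝓝 0) := continuous_neg.tendsto' _ _ neg_zero
  filter_upwards [hpos, hneg.eventually hpos] with t ht ht'
  have hint (i : ι) (t : ℝ) := integrable_flowGain hK hmem (v i) t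
    ((μ : Measure (sphere (0 : E) 1)).prod (μ : Measure (sphere (0 : E) 1)))
  have hint_add (i : ι) : Integrable (fun p ↦ flowGain K (v i) t p + flowGain K (v i) (-t) p) _ :=
    (hint i t).add (hint i (-t))
  rw [integral_finsetSum _ fun i _ ↦ hint_add i]
  refine Finset.sum_nonpos fun i _ ↦ ?_
  rw [integral_add (hint i t) (hint i (-t))]
  exact add_nonpos (ht i) (ht' i)

end FlowGain

section LocalMax

variable {E : Type*} [NormedAddCommGroup E] [InnerProductSpace ℝ E] [MeasurableSpace E]
  [BorelSpace E] [SecondCountableTopology E] {T : E →L[ℝ] E} {lam : ℝ} {φ : ℝ → ℝ} {ι : Type*}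
  [Fintype ι]

theorem integrable_sub_mul_sum_flowHessian {v : ι → sphere (0 : E) 1} (hι : 3 ≤ Fintype.card ι)
    (hv : Orthonormal ℝ fun i ↦ (v i : E)) (hT : ‖T‖ ≤ lam)
    (ρ : Measure (sphere (0 : E) 1 × sphere (0 : E) 1)) [IsFiniteMeasure ρ] :
    Integrable (fun p ↦ (lam - spherePairing T p) * ∑ i, flowHessian (v i : E) p.1 p.2) ρ := by
  have hcont : Continuous fun p : sphere (0 : E) 1 × sphere (0 : E) 1 ↦
      (lam - spherePairing T p) * ∑ i, flowHessian (v i : E) p.1 p.2 := by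
    have := continuous_spherePairing T
    unfold flowHessian
    fun_prop
  refine .of_mem_Icc 0 ((lam - -lam) * Fintype.card ι) hcont.measurable.aemeasurable
    (.of_forall fun p ↦ ?_)
  have hs := spherePairing_mem_Icc hT p
  have hsum_nonneg := sum_flowHessian_nonneg hι hv p.1 p.2
  have hsum_le : ∑ i, flowHessian (v i : E) p.1 p.2 ≤ Fintype.card ι := by
    simpa using Finset.sum_le_card_nsmul Finset.univ _ 1
      fun i _ ↦ flowHessian_le_one (v i : E) p.1 p.2
  exact ⟨mul_nonneg (sub_nonneg.2 hs.2) hsum_nonneg,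
    mul_le_mul (sub_le_sub_left hs.1 _) hsum_le hsum_nonneg (by linarith [hs.1, hs.2])⟩

theorem ae_spherePairing_eq_of_isWassersteinLocalMax {v : ι → sphere (0 : E) 1}
    (hι : 3 ≤ Fintype.card ι) (hv : Orthonormal ℝ fun i ↦ (v i : E)) (hlam : 0 < lam)
    (hT : ‖T‖ ≤ lam) (hTv : ∀ i, T (v i) = lam • (v i : E))
    (hφ : ConvexOn ℝ (Icc (-lam) lam) φ)
    (hd : 0 < derivWithin φ (Icc (-lam) lam) (-lam)) {μ : ProbabilityMeasure (sphere (0 : E) 1)}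
    (hμ : IsWassersteinLocalMax (kernelEnergy (φ ∘ spherePairing T)) μ) :
    ∀ᵐ p ∂((μ : Measure (sphere (0 : E) 1)).prod (μ : Measure (sphere (0 : E) 1))),
      spherePairing T p = lam := by
  set ρ := (μ : Measure (sphere (0 : E) 1)).prod (μ : Measure (sphere (0 : E) 1))
  set f : sphere (0 : E) 1 × sphere (0 : E) 1 → ℝ := fun p ↦
    derivWithin φ (Icc (-lam) lam) (-lam) *
      ((lam - spherePairing T p) * ∑ i, flowHessian (v i : E) p.1 p.2)
  have hmono := (strictMonoOn_of_convexOn_of_derivWithin_left_pos hφ hd).monotoneOn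
  have hK := measurable_comp_spherePairing hT hmono
  have hmem := comp_spherePairing_mem_Icc hT hmono
  have hf_nonneg (p) : 0 ≤ f p :=
    mul_nonneg hd.le (mul_nonneg (sub_nonneg.2 (spherePairing_mem_Icc hT p).2)
      (sum_flowHessian_nonneg hι hv p.1 p.2))
  have hf_int : Integrable f ρ := (integrable_sub_mul_sum_flowHessian hι hv hT ρ).const_mul _
  have hr : Tendsto (fun t ↦ 2 * sinh t ^ 2) (𝓝[≠] 0) (𝓝[>] 0) := by
    refine tendsto_nhdsWithin_iff.2 ⟨?_, ?_⟩
    · exact (Continuous.tendsto' (by fun_prop) 0 0 (by simp)).mono_left nhdsWithin_le_nhds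
    · filter_upwards [self_mem_nhdsWithin] with t ht
      have := sinh_ne_zero.2 ht
      exact mem_Ioi.2 (by positivity)
  have hf_integral : ∫ p, f p ∂ρ ≤ 0 := integral_nonpos_of_tendsto_nhdsGT_zero hr hf_int
    (fun t ↦ integrable_finsetSum _ fun i _ ↦ (integrable_flowGain hK hmem (v i) t ρ).add
      (integrable_flowGain hK hmem (v i) (-t) ρ))
    (le_sum_flowGain hι hv hlam hT hTv hφ hd)
    (nhdsWithin_le_nhds (eventually_integral_sum_flowGain_nonpos hK hmem hμ v))
  have hf_ae := (integral_eq_zero_iff_of_nonneg hf_nonneg hf_int).1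
    (hf_integral.antisymm (integral_nonneg hf_nonneg))
  filter_upwards [hf_ae] with p hp
  rcases mul_eq_zero.1 ((mul_eq_zero.1 hp).resolve_left hd.ne') with hgap | hhess
  · exact (sub_eq_zero.1 hgap).symm
  · exact inner_apply_eq_of_sum_flowHessian_eq_zero hι hv hTv hhess

theorem mainTheorem3_general (hι : 3 ≤ Fintype.card ι) {v : ι → E} (hv : Orthonormal ℝ v)
    (hlam : 0 < lam) (hT : ‖T‖ ≤ lam) (hTv : ∀ i, T (v i) = lam • v i)
    (hφ : ConvexOn ℝ (Icc (-lam) lam) φ) (hd : 0 < derivWithin φ (Icc (-lam) lam) (-lam))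
    (μ : ProbabilityMeasure (sphere (0 : E) 1)) :
    (IsWassersteinLocalMax (kernelEnergy (φ ∘ spherePairing T)) μ →
        IsGlobalMax (kernelEnergy (φ ∘ spherePairing T)) μ) ∧
      (IsGlobalMax (kernelEnergy (φ ∘ spherePairing T)) μ ↔
        ∃ x₀ : sphere (0 : E) 1, T x₀ = lam • (x₀ : E) ∧
          (μ : Measure (sphere (0 : E) 1)) = Measure.dirac x₀) := by
  lift v to ι → sphere (0 : E) 1 using fun i ↦ mem_sphere_zero_iff_norm.2 (hv.1 i)
  obtain ⟨i₀⟩ : Nonempty ι := Fintype.card_pos_iff.1 (by omega)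
  rw [isGlobalMax_kernelEnergy_comp_spherePairing_iff hT (hTv i₀)
    (strictMonoOn_of_convexOn_of_derivWithin_left_pos hφ hd)]
  exact ⟨ae_spherePairing_eq_of_isWassersteinLocalMax hι hv hlam hT hTv hφ hd,
    ae_spherePairing_eq_iff_exists_dirac hlam hT⟩

end LocalMax

section Spectral

variable {d : ℕ} {A : Matrix (Fin d) (Fin d) ℝ}

theorem sortedEigenvalue_antitone (hA : A.IsSymm) : Antitone (sortedEigenvalue hA) :=
  (symmOperator hA).eigenvalues_antitone finrank_euclideanSpace_fin

theorem mulVecE_eigenvectorBasis (hA : A.IsSymm) (i : Fin d) :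
    mulVecE A ((symmOperator hA).eigenvectorBasis finrank_euclideanSpace_fin i) =
      sortedEigenvalue hA i •
        (symmOperator hA).eigenvectorBasis finrank_euclideanSpace_fin i :=
  (symmOperator hA).apply_eigenvectorBasis finrank_euclideanSpace_fin i

theorem norm_toEuclideanCLM_le (hA : A.IsSymm) {r : ℝ} (hr : 0 ≤ r)
    (hle : ∀ i, |sortedEigenvalue hA i| ≤ r) :
    ‖Matrix.toEuclideanCLM (n := Fin d) (𝕜 := ℝ) A‖ ≤ r := by
  refine ContinuousLinearMap.opNorm_le_bound _ hr fun x ↦ ?_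
  set b := (symmOperator hA).eigenvectorBasis finrank_euclideanSpace_fin
  have hcoord (i : Fin d) : ⟪b i, mulVecE A x⟫ = sortedEigenvalue hA i * ⟪b i, x⟫ :=
    calc ⟪b i, mulVecE A x⟫ = ⟪mulVecE A (b i), x⟫ := (symmOperator hA (b i) x).symm
      _ = sortedEigenvalue hA i * ⟪b i, x⟫ := by
          rw [mulVecE_eigenvectorBasis, real_inner_smul_left]
  change ‖mulVecE A x‖ ≤ r * ‖x‖
  rw [← sq_le_sq₀ (norm_nonneg _) (by positivity), mul_pow, ← b.sum_sq_norm_inner_right,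
    ← b.sum_sq_norm_inner_right x, Finset.mul_sum]
  refine Finset.sum_le_sum fun i _ ↦ ?_
  rw [hcoord, norm_mul, mul_pow]
  exact mul_le_mul_of_nonneg_right (pow_le_pow_left₀ (norm_nonneg _) (hle i) 2) (sq_nonneg _)

theorem interactionEnergy_eq_kernelEnergy (A : Matrix (Fin d) (Fin d) ℝ) (φ : ℝ → ℝ) :
    interactionEnergy A φ =
      kernelEnergy (φ ∘ spherePairing (Matrix.toEuclideanCLM (n := Fin d) (𝕜 := ℝ) A)) :=
  rfl

theorem exists_orthonormal_mulVecE_eq_smul (hA : A.IsSymm) {r : ℝ} {ι : Type*} {f : ι → Fin d}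
    (hf : Function.Injective f) (h : ∀ i, sortedEigenvalue hA (f i) = r) :
    ∃ v : ι → EuclideanSpace ℝ (Fin d), Orthonormal ℝ v ∧ ∀ i, mulVecE A (v i) = r • v i :=
  ⟨_, ((symmOperator hA).eigenvectorBasis finrank_euclideanSpace_fin).orthonormal.comp f hf,
    fun i ↦ h i ▸ mulVecE_eigenvectorBasis hA (f i)⟩

end Spectral

theorem mainTheorem3 (d : ℕ) (hd : 3 ≤ d) (A : Matrix (Fin d) (Fin d) ℝ) (hA : A.IsSymm)
    (lam : ℝ) (hlam : 0 < lam)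
    (h1 : sortedEigenvalue hA ⟨0, by omega⟩ = lam)
    (h2 : sortedEigenvalue hA ⟨1, by omega⟩ = lam)
    (h3 : sortedEigenvalue hA ⟨2, by omega⟩ = lam)
    (hlast : |sortedEigenvalue hA ⟨d - 1, by omega⟩| ≤ lam)
    (φ : ℝ → ℝ)
    (hφ : DifferentiableOn ℝ φ (Set.Icc (-lam) lam))
    (hφ' : DifferentiableOn ℝ (derivWithin φ (Set.Icc (-lam) lam)) (Set.Icc (-lam) lam))
    (hincr : ∀ s ∈ Set.Icc (-lam) lam, 0 < derivWithin φ (Set.Icc (-lam) lam) s)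
    (hconv : ∀ s ∈ Set.Icc (-lam) lam,
      0 ≤ derivWithin (derivWithin φ (Set.Icc (-lam) lam)) (Set.Icc (-lam) lam) s) :
    ∀ μ : ProbabilityMeasure (UnitSphere d),
      (IsWassersteinLocalMax (interactionEnergy A φ) μ → IsGlobalMax (interactionEnergy A φ) μ) ∧
      (IsGlobalMax (interactionEnergy A φ) μ ↔
        ∃ x₀ : UnitSphere d,
          mulVecE A (x₀ : EuclideanSpace ℝ (Fin d)) = lam • (x₀ : EuclideanSpace ℝ (Fin d)) ∧
          (μ : Measure (UnitSphere d)) = Measure.dirac x₀) := by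
  have habs (i : Fin d) : |sortedEigenvalue hA i| ≤ lam :=
    abs_le.2 ⟨(abs_le.1 hlast).1.trans (sortedEigenvalue_antitone hA (Fin.mk_le_mk.2 (by omega))),
      h1 ▸ sortedEigenvalue_antitone hA (Fin.mk_le_mk.2 (Nat.zero_le _))⟩
  obtain ⟨v, hv, hAv⟩ := exists_orthonormal_mulVecE_eq_smul hA (Fin.castLE_injective hd)
    (r := lam) fun i ↦ by fin_cases i <;> assumption
  rw [interactionEnergy_eq_kernelEnergy]
  exact mainTheorem3_general (Fintype.card_fin 3).ge hv hlam
    (norm_toEuclideanCLM_le hA hlam.le habs) hAv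
    (convexOn_of_derivWithin2_nonneg (convex_Icc _ _) hφ hφ' hconv)
    (hincr _ (left_mem_Icc.2 (by linarith)))
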